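/- Let $\mathbf{Z}$ be a Borel space, i.e., a measurable space isomorphic to a Borel subset of $\mathbb{R}$, and let $\mathfrak{P}(\mathbf{Z})$ be the set of all probability measures on $\mathbf{Z}$. Equip the space $\mathbf{Z}^{\infty}$ of infinite sequences with the product $\sigma$-algebra, and write $Q^{\infty}$ for the infinite product of $Q\in\mathfrak{P}(\mathbf{Z})$ with itself. A probability measure $R$ on $\mathbf{Z}^{\infty}$ is exchangeable if it is invariant with respect to swapping any pair of observations. For events $A\subseteq\mathbf{Z}^{\infty}$ and measurable functions $F:\mathbf{Z}^{\infty}\to[0,\infty]$ define $$\mathrm{UXP}(A):=\sup_{R}R(A),\quad \mathrm{URP}(A):=\sup_{Q\in\mathfrak{P}(\mathbf{Z})}Q^{\infty}(A),\quad \mathrm{UXE}(F):=\sup_{R}\int F\,dR,\quad \mathrm{URE}(F):=\sup_{Q\in\mathfrak{P}(\mathbf{Z})}\int F\,dQ^{\infty},$$ where $R$ ranges over the exchangeable probability measures on $\mathbf{Z}^{\infty}$. Then: 1. $\mathrm{UXP}(A)=\mathrm{URP}(A)$ for every event $A\subseteq\mathbf{Z}^{\infty}$. 2. $\mathrm{UXE}(F)=\mathrm{URE}(F)$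 for every measurable $F:\mathbf{Z}^{\infty}\to[0,\infty]$. 3. For every $\epsilon\in(0,1)$, the critical regions at level $\epsilon$ for testing exchangeability (events $A$ with $\mathrm{UXP}(A)\le\epsilon$) and for testing randomness (events $A$ with $\mathrm{URP}(A)\le\epsilon$) are the same. 4. Exchangeability p-variables (measurable $P:\mathbf{Z}^{\infty}\to[0,1]$ with $\mathrm{UXP}(P\le\epsilon)\le\epsilon$ for all $\epsilon\in(0,1)$) and randomness p-variables (measurable $P:\mathbf{Z}^{\infty}\to[0,1]$ with $\mathrm{URP}(P\le\epsilon)\le\epsilon$ for all $\epsilon\in(0,1)$) are the same. 5. Exchangeability e-variables (measurable $F:\mathbf{Z}^{\infty}\to[0,\infty]$ with $\mathrm{UXE}(F)\le1$) and randomness e-variables (measurable $F:\mathbf{Z}^{\infty}\to[0,\infty]$ with $\mathrm{URE}(F)\le1$) are the same. -/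

import Mathlib

open MeasureTheory
open scoped ENNReal

noncomputable section

/-- A probability measure on `Z^∞` is exchangeable if it is invariant with respect to swapping
any pair of observations. -/
def IsExchangeable {Z : Type*} [MeasurableSpace Z] (R : ProbabilityMeasure (ℕ → Z)) : Prop :=
  ∀ i j : ℕ, (R : Measure (ℕ → Z)).map (fun z n => z (Equiv.swap i j n)) = (R : Measure (ℕ → Z))

/-- The product measure `Q^∞` on `Z^∞`. -/
def iidMeasure {Z : Type*} [MeasurableSpace Z] (Q : ProbabilityMeasure Z) : Measure (ℕ → Z) :=
  Measure.infinitePi (fun _ : ℕ => (Q : Measure Z))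

/-- Upper exchangeability probability. -/
def UXP {Z : Type*} [MeasurableSpace Z] (A : Set (ℕ → Z)) : ℝ≥0∞ :=
  ⨆ (R : ProbabilityMeasure (ℕ → Z)) (_ : IsExchangeable R), (R : Measure (ℕ → Z)) A

/-- Upper randomness probability. -/
def URP {Z : Type*} [MeasurableSpace Z] (A : Set (ℕ → Z)) : ℝ≥0∞ :=
  ⨆ Q : ProbabilityMeasure Z, iidMeasure Q A

/-- Upper exchangeability expectation. -/
def UXE {Z : Type*} [MeasurableSpace Z] (F : (ℕ → Z) → ℝ≥0∞) : ℝ≥0∞ :=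
  ⨆ (R : ProbabilityMeasure (ℕ → Z)) (_ : IsExchangeable R), ∫⁻ z, F z ∂(R : Measure (ℕ → Z))

/-- Upper randomness expectation. -/
def URE {Z : Type*} [MeasurableSpace Z] (F : (ℕ → Z) → ℝ≥0∞) : ℝ≥0∞ :=
  ⨆ Q : ProbabilityMeasure Z, ∫⁻ z, F z ∂(iidMeasure Q)

/-- Critical region at level `ε` for testing exchangeability. -/
def IsExchangeabilityCriticalRegion {Z : Type*} [MeasurableSpace Z] (ε : ℝ)
    (A : Set (ℕ → Z)) : Prop :=
  MeasurableSet A ∧ UXP A ≤ ENNReal.ofReal ε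

/-- Critical region at level `ε` for testing randomness. -/
def IsRandomnessCriticalRegion {Z : Type*} [MeasurableSpace Z] (ε : ℝ)
    (A : Set (ℕ → Z)) : Prop :=
  MeasurableSet A ∧ URP A ≤ ENNReal.ofReal ε

/-- Exchangeability p-variable, with values in `[0,1]`. -/
def IsExchangeabilityPVariable {Z : Type*} [MeasurableSpace Z]
    (P : (ℕ → Z) → unitInterval) : Prop :=
  Measurable P ∧ ∀ ε ∈ Set.Ioo (0 : ℝ) 1, UXP {z | (P z : ℝ) ≤ ε} ≤ ENNReal.ofReal ε

/-- Randomness p-variable, with values in `[0,1]`. -/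
def IsRandomnessPVariable {Z : Type*} [MeasurableSpace Z]
    (P : (ℕ → Z) → unitInterval) : Prop :=
  Measurable P ∧ ∀ ε ∈ Set.Ioo (0 : ℝ) 1, URP {z | (P z : ℝ) ≤ ε} ≤ ENNReal.ofReal ε

/-- Exchangeability e-variable, with values in `[0,∞]`. -/
def IsExchangeabilityEVariable {Z : Type*} [MeasurableSpace Z]
    (F : (ℕ → Z) → ℝ≥0∞) : Prop :=
  Measurable F ∧ UXE F ≤ 1

/-- Randomness e-variable, with values in `[0,∞]`. -/
def IsRandomnessEVariable {Z : Type*} [MeasurableSpace Z]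
    (F : (ℕ → Z) → ℝ≥0∞) : Prop :=
  Measurable F ∧ URE F ≤ 1

end

/-!
The empirical means of a bounded function of exchangeable observations are Cesàro means of vectors
with constant pairwise inner products in `L²`. Such means form a Cauchy sequence, since
`‖mₙ - mₖ‖² = (d - c) (1/n - 1/k)` for `n ≤ k`, so along a subsequence they converge almost surely,
and their limit `g` is invariant under finite permutations. If `H` depends on finitely many
observations other than `z k`, then swapping `k` with a remote `j` shows that `f (z k)` and
`f (z j)` have the same correlation with `H` on every event of the exchangeable σ-algebra; averaging
over `j`, one may replace `f (z k)` by `g`. Hence the observations are conditionally i.i.d. given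
the exchangeable σ-algebra, which makes every exchangeable law a mixture of laws `Q^∞` (the theorem
of de Finetti). An integral against a mixture is at most the supremum of the integrals against its
components, and conversely each `Q^∞` is exchangeable.
-/

open Filter Topology ProbabilityTheory

section CesaroMean

/-- The Cesàro mean `(x 0 + ⋯ + x (n - 1)) / n` of a sequence; it is `0` for `n = 0`. Applied to
`x i = f (z i)` it is the empirical mean of `f` over the first `n` observations. -/
noncomputable def cesaroMean {E : Type*} [AddCommMonoid E] [Module ℝ E] (x : ℕ → E) (n : ℕ) : E :=
  (n : ℝ)⁻¹ • ∑ i ∈ Finset.range n, x i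

theorem norm_cesaroMean_le {E : Type*} [SeminormedAddCommGroup E] [NormedSpace ℝ E] {x : ℕ → E}
    {C : ℝ} (hx : ∀ i, ‖x i‖ ≤ C) (n : ℕ) : ‖cesaroMean x n‖ ≤ C := by
  have hC : 0 ≤ C := (norm_nonneg _).trans (hx 0)
  calc ‖cesaroMean x n‖ = (n : ℝ)⁻¹ * ‖∑ i ∈ Finset.range n, x i‖ := by
        rw [cesaroMean, norm_smul, norm_inv, Real.norm_natCast]
    _ ≤ (n : ℝ)⁻¹ * (n * C) := by
        gcongr
        simpa using norm_sum_le_of_le (Finset.range n) fun i _ => hx i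
    _ ≤ C := by
        rw [← mul_assoc]
        exact mul_le_of_le_one_left hC inv_mul_le_one

theorem mul_cesaroMean (a : ℝ) (x : ℕ → ℝ) (n : ℕ) :
    a * cesaroMean x n = cesaroMean (fun i => a * x i) n := by
  simp only [cesaroMean, smul_eq_mul, Finset.mul_sum]
  exact Finset.sum_congr rfl fun i _ => mul_left_comm a _ _

theorem integral_cesaroMean {Ω E : Type*} [MeasurableSpace Ω] {μ : Measure Ω}
    [NormedAddCommGroup E] [NormedSpace ℝ E] {X : ℕ → Ω → E} (hX : ∀ i, Integrable (X i) μ)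
    (n : ℕ) : ∫ ω, cesaroMean (X · ω) n ∂μ = cesaroMean (fun i => ∫ ω, X i ω ∂μ) n := by
  simp only [cesaroMean]
  rw [integral_smul, integral_finsetSum _ fun i _ => hX i]

theorem cesaroMean_comp_swap {E : Type*} [AddCommMonoid E] [Module ℝ E] (x : ℕ → E) {i j n : ℕ}
    (hi : i < n) (hj : j < n) : cesaroMean (x ∘ Equiv.swap i j) n = cesaroMean x n := by
  have hswap : ∀ k, k ∈ Finset.range n ↔ Equiv.swap i j k ∈ Finset.range n := fun k => by
    simp only [Finset.mem_range, Equiv.swap_apply_def]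
    split_ifs <;> omega
  exact congrArg _ (Finset.sum_equiv (Equiv.swap i j) hswap fun _ _ => rfl)

end CesaroMean

section ConstantCorrelations

variable {E : Type*} [NormedAddCommGroup E] [InnerProductSpace ℝ E] {x : ℕ → E} {c d : ℝ}

theorem inner_cesaroMean_of_inner_eq (hx : ∀ i j, inner ℝ (x i) (x j) = if i = j then d else c)
    {n m : ℕ} (hn : 0 < n) (hnm : n ≤ m) :
    inner ℝ (cesaroMean x n) (cesaroMean x m) = c + (d - c) / m := by
  have hm : 0 < m := hn.trans_le hnm
  have row_sum : ∀ i ∈ Finset.range n,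
      ∑ j ∈ Finset.range m, inner ℝ (x i) (x j) = m * c + (d - c) := by
    intro i hi
    have him : i ∈ Finset.range m := Finset.range_mono hnm hi
    have split_diagonal : ∀ j, inner ℝ (x i) (x j) = c + if i = j then d - c else 0 := fun j => by
      rw [hx]
      split_ifs <;> ring
    simp [split_diagonal, Finset.sum_add_distrib, Finset.mem_range.1 him]
  rw [cesaroMean, cesaroMean, real_inner_smul_left, real_inner_smul_right, sum_inner]
  simp only [inner_sum]
  rw [Finset.sum_congr rfl row_sum, Finset.sum_const, Finset.card_range, nsmul_eq_mul]
  field_simp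

theorem norm_cesaroMean_sub_sq_of_inner_eq
    (hx : ∀ i j, inner ℝ (x i) (x j) = if i = j then d else c) {n m : ℕ} (hn : 0 < n)
    (hnm : n ≤ m) :
    ‖cesaroMean x n - cesaroMean x m‖ ^ 2 = (d - c) / n - (d - c) / m := by
  rw [norm_sub_sq_real, ← real_inner_self_eq_norm_sq, ← real_inner_self_eq_norm_sq,
    inner_cesaroMean_of_inner_eq hx hn hnm, inner_cesaroMean_of_inner_eq hx hn le_rfl,
    inner_cesaroMean_of_inner_eq hx (hn.trans_le hnm) le_rfl]
  ring

theorem cauchySeq_cesaroMean_of_inner_eq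
    (hx : ∀ i j, inner ℝ (x i) (x j) = if i = j then d else c) : CauchySeq (cesaroMean x) := by
  have hcd : 0 ≤ d - c := by
    have h := norm_cesaroMean_sub_sq_of_inner_eq hx one_pos one_le_two
    have := sq_nonneg ‖cesaroMean x 1 - cesaroMean x 2‖
    norm_num at h
    linarith
  rw [← cauchySeq_shift 1]
  refine cauchySeq_of_le_tendsto_0' (fun n : ℕ => √((d - c) * (1 / (n + 1)))) (fun n m hnm => ?_) ?_
  · rw [dist_eq_norm]
    refine Real.le_sqrt_of_sq_le ?_
    rw [norm_cesaroMean_sub_sq_of_inner_eq hx n.succ_pos (by omega), mul_one_div]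
    push_cast
    exact sub_le_self _ (by positivity)
  · simpa using (tendsto_one_div_add_atTop_nhds_zero_nat.const_mul (d - c)).sqrt

end ConstantCorrelations

section RandomSequences

variable {Ω : Type*} [MeasurableSpace Ω] {μ : Measure Ω} {X : ℕ → Ω → ℝ}

theorem exists_subseq_ae_tendsto_cesaroMean {c d : ℝ} (hX : ∀ i, MemLp (X i) 2 μ)
    (hcorr : ∀ i j, ∫ ω, X i ω * X j ω ∂μ = if i = j then d else c) :
    ∃ ns : ℕ → ℕ, StrictMono ns ∧
      ∀ᵐ ω ∂μ, ∃ l, Tendsto (fun k => cesaroMean (X · ω) (ns k)) atTop (𝓝 l) := by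
  let Y : ℕ → Lp ℝ 2 μ := fun i => (hX i).toLp
  have hY : ∀ i, Y i =ᵐ[μ] X i := fun i => (hX i).coeFn_toLp
  have hinner : ∀ i j, inner ℝ (Y i) (Y j) = if i = j then d else c := by
    intro i j
    rw [L2.inner_def, ← hcorr i j]
    refine integral_congr_ae ?_
    filter_upwards [hY i, hY j] with ω hi hj
    simp [hi, hj, mul_comm]
  have hmean : ∀ n, ⇑(cesaroMean Y n) =ᵐ[μ] fun ω => cesaroMean (X · ω) n := by
    intro n
    filter_upwards [Lp.coeFn_smul (n : ℝ)⁻¹ (∑ i ∈ Finset.range n, Y i),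
      Lp.coeFn_finsetSum (Finset.range n) Y, ae_all_iff.2 hY] with ω hsmul hsum hYω
    simp only [cesaroMean, hsmul, Pi.smul_apply, hsum, Finset.sum_apply, hYω]
  obtain ⟨L, hL⟩ := cauchySeq_tendsto_of_complete (cauchySeq_cesaroMean_of_inner_eq hinner)
  obtain ⟨ns, hns, hlim⟩ := (tendstoInMeasure_of_tendsto_Lp hL).exists_seq_tendsto_ae
  refine ⟨ns, hns, ?_⟩
  filter_upwards [hlim, ae_all_iff.2 hmean] with ω hω hmeanω
  exact ⟨L ω, by simpa only [hmeanω] using hω⟩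

theorem integral_mul_eq_of_tendsto_cesaroMean {C e : ℝ} {g H : Ω → ℝ} {ns : ℕ → ℕ}
    (hX : ∀ i, AEStronglyMeasurable (X i) μ) (hXC : ∀ i ω, ‖X i ω‖ ≤ C) (hns : StrictMono ns)
    (hg : ∀ᵐ ω ∂μ, Tendsto (fun k => cesaroMean (X · ω) (ns k)) atTop (𝓝 (g ω)))
    (hH : Integrable H μ) (he : Tendsto (fun i => ∫ ω, H ω * X i ω ∂μ) atTop (𝓝 e)) :
    ∫ ω, H ω * g ω ∂μ = e := by
  have hHX : ∀ i, Integrable (fun ω => H ω * X i ω) μ := fun i =>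
    hH.mul_bdd (hX i) (ae_of_all _ (hXC i))
  have integral_mean : ∀ n, ∫ ω, H ω * cesaroMean (X · ω) n ∂μ =
      cesaroMean (fun i => ∫ ω, H ω * X i ω ∂μ) n := fun n => by
    simp only [mul_cesaroMean]
    exact integral_cesaroMean hHX n
  have tendsto_left : Tendsto (fun k => ∫ ω, H ω * cesaroMean (X · ω) (ns k) ∂μ) atTop
      (𝓝 (∫ ω, H ω * g ω ∂μ)) := by
    refine tendsto_integral_of_dominated_convergence (fun ω => ‖H ω‖ * C) (fun k => ?_)
      (hH.norm.mul_const C) (fun k => ae_of_all _ fun ω => ?_) ?_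
    · exact hH.aestronglyMeasurable.mul
        ((Finset.aestronglyMeasurable_fun_sum _ fun i _ => hX i).const_smul (ns k : ℝ)⁻¹)
    · rw [norm_mul]
      exact mul_le_mul_of_nonneg_left (norm_cesaroMean_le (hXC · ω) _) (norm_nonneg _)
    · filter_upwards [hg] with ω hω using hω.const_mul _
  simp only [integral_mean] at tendsto_left
  exact tendsto_nhds_unique tendsto_left (he.cesaro_smul.comp hns.tendsto_atTop)

end RandomSequences

section ExchangeableSigmaAlgebra

variable {Z : Type*} [MeasurableSpace Z]

/-- The σ-algebra of measurable events in `Z^∞` that are invariant under swapping any pair of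
coordinates, hence under all finite permutations. Conditioning on it turns exchangeable
observations into i.i.d. ones. -/
abbrev exchangeableSigmaAlgebra (Z : Type*) [MeasurableSpace Z] : MeasurableSpace (ℕ → Z) :=
  ⨅ (i : ℕ) (j : ℕ), MeasurableSpace.invariants fun z => z ∘ Equiv.swap i j

theorem measurableSet_exchangeableSigmaAlgebra_iff {T : Set (ℕ → Z)} :
    MeasurableSet[exchangeableSigmaAlgebra Z] T ↔
      MeasurableSet T ∧ ∀ i j, (fun z => z ∘ Equiv.swap i j) ⁻¹' T = T := by
  simp only [MeasurableSpace.measurableSet_iInf, MeasurableSpace.measurableSet_invariants,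
    forall_and, forall_const]

theorem exchangeableSigmaAlgebra_le :
    exchangeableSigmaAlgebra Z ≤ (MeasurableSpace.pi : MeasurableSpace (ℕ → Z)) :=
  fun _ hT => (measurableSet_exchangeableSigmaAlgebra_iff.1 hT).1

theorem measurable_exchangeableSigmaAlgebra {β : Type*} [MeasurableSpace β] {g : (ℕ → Z) → β}
    (hg : Measurable g) (hswap : ∀ i j z, g (z ∘ Equiv.swap i j) = g z) :
    Measurable[exchangeableSigmaAlgebra Z] g := fun s hs =>
  measurableSet_exchangeableSigmaAlgebra_iff.2
    ⟨hg hs, fun i j => Set.ext fun z => by simp only [Set.mem_preimage, hswap]⟩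

end ExchangeableSigmaAlgebra

section InfiniteProducts

variable {ι Z : Type*} [MeasurableSpace Z]

theorem measure_ext_of_finite_pi {μ ν : Measure (ι → Z)} [IsFiniteMeasure μ]
    (h : ∀ (I : Finset ι) (t : ι → Set Z), (∀ i, MeasurableSet (t i)) →
      μ ((I : Set ι).pi t) = ν ((I : Set ι).pi t)) : μ = ν := by
  refine ext_of_generate_finite _ generateFrom_squareCylinders.symm
    (isPiSystem_squareCylinders (fun _ => MeasurableSpace.isPiSystem_measurableSet)
      fun _ => MeasurableSet.univ) ?_ ?_
  · rintro _ ⟨I, t, ht, rfl⟩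
    exact h I t fun i => ht i trivial
  · simpa using h ∅ (fun _ => .univ) fun _ => .univ

theorem measurable_infinitePi {α : Type*} [MeasurableSpace α] {Q : α → Measure Z}
    [∀ a, IsProbabilityMeasure (Q a)] (hQ : Measurable Q) :
    Measurable fun a => Measure.infinitePi fun _ : ι => Q a := by
  refine .measure_of_isPiSystem_of_isProbabilityMeasure generateFrom_squareCylinders.symm
    (isPiSystem_squareCylinders (fun _ => MeasurableSpace.isPiSystem_measurableSet)
      fun _ => MeasurableSet.univ) ?_
  rintro _ ⟨I, t, ht, rfl⟩
  have htm : ∀ i, MeasurableSet (t i) := fun i => ht i trivial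
  simp only [Measure.infinitePi_pi _ fun i _ => htm i]
  exact Finset.measurable_fun_prod _ fun i _ => (Measure.measurable_coe (htm i)).comp hQ

end InfiniteProducts

theorem measurableEmbedding_comp_equiv {ι κ Z : Type*} [MeasurableSpace Z] (e : ι ≃ κ) :
    MeasurableEmbedding fun z : κ → Z => z ∘ e :=
  (MeasurableEquiv.arrowCongr' e.symm (.refl Z)).measurableEmbedding

theorem comp_swap_mem_pi_iff {ι Z : Type*} [DecidableEq ι] {S : Set ι} {s : ι → Set Z} {k j : ι}
    (hk : k ∉ S) (hj : j ∉ S) {z : ι → Z} : z ∘ Equiv.swap k j ∈ S.pi s ↔ z ∈ S.pi s := by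
  refine forall₂_congr fun i hi => ?_
  rw [Function.comp_apply, Equiv.swap_apply_of_ne_of_ne (ne_of_mem_of_not_mem hi hk)
    (ne_of_mem_of_not_mem hi hj)]

section DirectingMeasure

variable {Z : Type*} [MeasurableSpace Z] [StandardBorelSpace Z] (R : ProbabilityMeasure (ℕ → Z))

/-- The directing measure of a law `R` on `Z^∞`: the regular conditional law of one observation
given the exchangeable σ-algebra. For exchangeable `R` the choice of observation `0` is
immaterial. -/
noncomputable def directingKernel : Kernel[exchangeableSigmaAlgebra Z] (ℕ → Z) Z :=
  (condExpKernel (R : Measure (ℕ → Z)) (exchangeableSigmaAlgebra Z)).map fun z => z 0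

instance (z : ℕ → Z) : IsProbabilityMeasure (directingKernel R z) :=
  (Kernel.IsMarkovKernel.map _ (measurable_pi_apply 0)).isProbabilityMeasure z

theorem measurable_infinitePi_directingKernel :
    Measurable fun z => Measure.infinitePi fun _ : ℕ => directingKernel R z :=
  measurable_infinitePi ((directingKernel R).measurable.mono exchangeableSigmaAlgebra_le le_rfl)

end DirectingMeasure

namespace IsExchangeable

section Swaps

variable {Z : Type*} [MeasurableSpace Z] {R : ProbabilityMeasure (ℕ → Z)}
  {E : Type*} [NormedAddCommGroup E] [NormedSpace ℝ E]

theorem measurePreserving_swap (hR : IsExchangeable R) (i j : ℕ) :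
    MeasurePreserving (fun z : ℕ → Z => z ∘ Equiv.swap i j) R R :=
  ⟨(measurableEmbedding_comp_equiv _).measurable, hR i j⟩

theorem integral_comp_swap (hR : IsExchangeable R) (i j : ℕ) (g : (ℕ → Z) → E) :
    ∫ z, g (z ∘ Equiv.swap i j) ∂(R : Measure (ℕ → Z)) = ∫ z, g z ∂(R : Measure (ℕ → Z)) :=
  (hR.measurePreserving_swap i j).integral_comp (measurableEmbedding_comp_equiv _) g

theorem setIntegral_comp_swap (hR : IsExchangeable R) {T : Set (ℕ → Z)}
    (hT : MeasurableSet[exchangeableSigmaAlgebra Z] T) (i j : ℕ) (g : (ℕ → Z) → E) :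
    ∫ z in T, g (z ∘ Equiv.swap i j) ∂(R : Measure (ℕ → Z)) =
      ∫ z in T, g z ∂(R : Measure (ℕ → Z)) := by
  have key := (hR.measurePreserving_swap i j).setIntegral_preimage_emb
    (measurableEmbedding_comp_equiv _) g T
  rwa [(measurableSet_exchangeableSigmaAlgebra_iff.1 hT).2 i j] at key

theorem condExp_comp_swap [CompleteSpace E] (hR : IsExchangeable R) {g : (ℕ → Z) → E}
    (hg : Integrable g (R : Measure (ℕ → Z))) (i j : ℕ) :
    (R : Measure (ℕ → Z))[fun z => g (z ∘ Equiv.swap i j) | exchangeableSigmaAlgebra Z]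
      =ᵐ[(R : Measure (ℕ → Z))] (R : Measure (ℕ → Z))[g | exchangeableSigmaAlgebra Z] := by
  have hg_swap : Integrable (fun z => g (z ∘ Equiv.swap i j)) (R : Measure (ℕ → Z)) :=
    (hR.measurePreserving_swap i j).integrable_comp_of_integrable hg
  refine ae_eq_condExp_of_forall_setIntegral_eq exchangeableSigmaAlgebra_le hg
    (fun _ _ _ => integrable_condExp.integrableOn) (fun T hT _ => ?_)
    stronglyMeasurable_condExp.aestronglyMeasurable
  rw [setIntegral_condExp exchangeableSigmaAlgebra_le hg_swap hT, hR.setIntegral_comp_swap hT]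

theorem integral_mul_eval_eq (hR : IsExchangeable R) (f : Z → ℝ) (i j : ℕ) :
    ∫ z, f (z i) * f (z j) ∂(R : Measure (ℕ → Z)) =
      if i = j then ∫ z, f (z 0) * f (z 0) ∂(R : Measure (ℕ → Z))
      else ∫ z, f (z 0) * f (z 1) ∂(R : Measure (ℕ → Z)) := by
  have relabel : ∀ a b i j : ℕ,
      ∫ z, f (z (Equiv.swap a b i)) * f (z (Equiv.swap a b j)) ∂(R : Measure (ℕ → Z)) =
        ∫ z, f (z i) * f (z j) ∂(R : Measure (ℕ → Z)) := fun a b i j =>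
    hR.integral_comp_swap a b fun z => f (z i) * f (z j)
  split_ifs with hij
  · subst hij
    simpa using (relabel 0 i i i).symm
  · have hj : Equiv.swap 0 i j ≠ 0 := fun h => hij (by
      simpa using (congrArg (Equiv.swap 0 i) h).symm)
    rw [← relabel 0 i i j, Equiv.swap_apply_right, ← relabel 1 (Equiv.swap 0 i j) 0,
      Equiv.swap_apply_right, Equiv.swap_apply_of_ne_of_ne zero_ne_one hj.symm]

end Swaps

section EmpiricalMeans

variable {Z : Type*} [MeasurableSpace Z] {R : ProbabilityMeasure (ℕ → Z)} {f : Z → ℝ}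

theorem exists_ae_tendsto_cesaroMean (hR : IsExchangeable R) (hf : Measurable f)
    (hf2 : MemLp (fun z => f (z 0)) 2 (R : Measure (ℕ → Z))) :
    ∃ (g : (ℕ → Z) → ℝ) (ns : ℕ → ℕ), Measurable[exchangeableSigmaAlgebra Z] g ∧ StrictMono ns ∧
      ∀ᵐ z ∂(R : Measure (ℕ → Z)),
        Tendsto (fun k => cesaroMean (fun i => f (z i)) (ns k)) atTop (𝓝 (g z)) := by
  have memLp_eval : ∀ i, MemLp (fun z => f (z i)) 2 (R : Measure (ℕ → Z)) := fun i => by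
    simpa [Function.comp_def] using
      hf2.comp_measurePreserving (hR.measurePreserving_swap 0 i)
  obtain ⟨ns, hns, hlim⟩ := exists_subseq_ae_tendsto_cesaroMean memLp_eval
    (hR.integral_mul_eval_eq f)
  refine ⟨fun z => limsup (fun k => cesaroMean (fun i => f (z i)) (ns k)) atTop, ns,
    measurable_exchangeableSigmaAlgebra (Measurable.limsup fun k => ?_) fun i j z => ?_, hns, ?_⟩
  · unfold cesaroMean
    fun_prop
  -- Swapping `i` and `j` does not affect means over more than `max i j` observations.
  · refine limsup_congr ?_
    filter_upwards [hns.tendsto_atTop.eventually_gt_atTop i,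
      hns.tendsto_atTop.eventually_gt_atTop j] with k hi hj
    exact cesaroMean_comp_swap (fun l => f (z l)) hi hj
  · filter_upwards [hlim] with z ⟨l, hl⟩
    rwa [hl.limsup_eq]

theorem condExp_mul_eval_eq_mul_limit (hR : IsExchangeable R) (hf : Measurable f) {C : ℝ}
    (hC : ∀ x, ‖f x‖ ≤ C) {g : (ℕ → Z) → ℝ} {ns : ℕ → ℕ}
    (hgm : Measurable[exchangeableSigmaAlgebra Z] g) (hns : StrictMono ns)
    (hg : ∀ᵐ z ∂(R : Measure (ℕ → Z)),
      Tendsto (fun k => cesaroMean (fun i => f (z i)) (ns k)) atTop (𝓝 (g z)))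
    {H : (ℕ → Z) → ℝ} (hH : Integrable H (R : Measure (ℕ → Z))) {k : ℕ}
    (hHk : ∀ᶠ j in atTop, ∀ z, H (z ∘ Equiv.swap k j) = H z) :
    (R : Measure (ℕ → Z))[fun z => H z * f (z k) | exchangeableSigmaAlgebra Z]
      =ᵐ[(R : Measure (ℕ → Z))] (R : Measure (ℕ → Z))[H | exchangeableSigmaAlgebra Z] * g := by
  have hm := exchangeableSigmaAlgebra_le (Z := Z)
  have measurable_eval : ∀ i, Measurable fun z : ℕ → Z => f (z i) := fun i => by fun_prop
  have hgC : ∀ᵐ z ∂(R : Measure (ℕ → Z)), ‖g z‖ ≤ C := by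
    filter_upwards [hg] with z hz
    exact le_of_tendsto hz.norm (.of_forall fun n => norm_cesaroMean_le (fun i => hC (z i)) _)
  have hHf : Integrable (fun z => H z * f (z k)) (R : Measure (ℕ → Z)) :=
    hH.mul_bdd (measurable_eval k).aestronglyMeasurable (ae_of_all _ fun z => hC (z k))
  have hHg : Integrable (H * g) (R : Measure (ℕ → Z)) :=
    hH.mul_bdd (hgm.mono hm le_rfl).aestronglyMeasurable hgC
  have setIntegral_eq : ∀ T, MeasurableSet[exchangeableSigmaAlgebra Z] T →
      ∫ z in T, H z * g z ∂(R : Measure (ℕ → Z)) =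
        ∫ z in T, H z * f (z k) ∂(R : Measure (ℕ → Z)) := by
    intro T hT
    refine integral_mul_eq_of_tendsto_cesaroMean (fun i => (measurable_eval i).aestronglyMeasurable)
      (fun i z => hC (z i)) hns (ae_restrict_of_ae hg) hH.restrict ?_
    refine tendsto_const_nhds.congr' ?_
    filter_upwards [hHk] with j hj
    rw [← hR.setIntegral_comp_swap hT k j]
    simp [hj]
  calc (R : Measure (ℕ → Z))[fun z => H z * f (z k) | exchangeableSigmaAlgebra Z]
      =ᵐ[(R : Measure (ℕ → Z))] (R : Measure (ℕ → Z))[H * g | exchangeableSigmaAlgebra Z] :=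
        (ae_eq_condExp_of_forall_setIntegral_eq hm hHf
          (fun _ _ _ => integrable_condExp.integrableOn)
          (fun T hT _ => (setIntegral_condExp hm hHg hT).trans (setIntegral_eq T hT))
          stronglyMeasurable_condExp.aestronglyMeasurable).symm
    _ =ᵐ[(R : Measure (ℕ → Z))] (R : Measure (ℕ → Z))[H | exchangeableSigmaAlgebra Z] * g :=
        condExp_mul_of_stronglyMeasurable_right hgm.stronglyMeasurable hHg hH

theorem condExp_mul_eval (hR : IsExchangeable R) (hf : Measurable f) {C : ℝ}
    (hC : ∀ x, ‖f x‖ ≤ C) {H : (ℕ → Z) → ℝ} (hH : Integrable H (R : Measure (ℕ → Z))) {k : ℕ}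
    (hHk : ∀ᶠ j in atTop, ∀ z, H (z ∘ Equiv.swap k j) = H z) :
    (R : Measure (ℕ → Z))[fun z => H z * f (z k) | exchangeableSigmaAlgebra Z]
      =ᵐ[(R : Measure (ℕ → Z))] (R : Measure (ℕ → Z))[H | exchangeableSigmaAlgebra Z] *
        (R : Measure (ℕ → Z))[fun z => f (z k) | exchangeableSigmaAlgebra Z] := by
  have hf2 : MemLp (fun z => f (z 0)) 2 (R : Measure (ℕ → Z)) :=
    .of_bound (by fun_prop : Measurable _).aestronglyMeasurable C (ae_of_all _ fun z => hC _)
  obtain ⟨g, ns, hgm, hns, hg⟩ := hR.exists_ae_tendsto_cesaroMean hf hf2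
  have hg_eq : (R : Measure (ℕ → Z))[fun z => f (z k) | exchangeableSigmaAlgebra Z]
      =ᵐ[(R : Measure (ℕ → Z))] g := by
    have h := hR.condExp_mul_eval_eq_mul_limit hf hC hgm hns hg (H := fun _ => 1)
      (integrable_const _) (k := k) (.of_forall fun _ _ => rfl)
    rw [condExp_const exchangeableSigmaAlgebra_le] at h
    simpa only [one_mul] using h.trans (.of_eq (one_mul g))
  filter_upwards [hR.condExp_mul_eval_eq_mul_limit hf hC hgm hns hg hH hHk, hg_eq] with z hz hgz
  rw [hz, Pi.mul_apply, Pi.mul_apply, hgz]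

end EmpiricalMeans

section ConditionalIndependence

variable {Z : Type*} [MeasurableSpace Z] [StandardBorelSpace Z] {R : ProbabilityMeasure (ℕ → Z)}

theorem iCondIndepFun_eval (hR : IsExchangeable R) :
    iCondIndepFun (exchangeableSigmaAlgebra Z) exchangeableSigmaAlgebra_le
      (fun (i : ℕ) (z : ℕ → Z) => z i) (R : Measure (ℕ → Z)) := by
  rw [iCondIndepFun_iff_condExp_inter_preimage_eq_mul _ _ fun i => measurable_pi_apply i]
  intro S s hs
  induction S using Finset.induction_on with
  | empty =>
    simp only [Finset.notMem_empty, Set.iInter_of_empty, Set.iInter_univ, Set.indicator_univ,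
      Finset.prod_empty, condExp_const exchangeableSigmaAlgebra_le]
    rfl
  | insert k S hk ih =>
    set B : Set (ℕ → Z) := ⋂ i ∈ S, (fun z => z i) ⁻¹' s i
    have hB_pi : B = (S : Set ℕ).pi s := (Set.pi_def _ _).symm
    have hBm : MeasurableSet B := hB_pi ▸ .pi S.countable_toSet fun i hi =>
      hs i (Finset.mem_insert_of_mem hi)
    have indicator_B_swap : ∀ᶠ j in atTop, ∀ z,
        B.indicator (fun _ => (1 : ℝ)) (z ∘ Equiv.swap k j) = B.indicator (fun _ => 1) z := by
      filter_upwards [S.eventually_all.2 fun i _ => eventually_ne_atTop i] with j hj z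
      rw [hB_pi]
      exact Set.indicator_const_eq_indicator_const
        (comp_swap_mem_pi_iff hk fun hjS => hj j hjS rfl)
    have indicator_insert : (⋂ i ∈ insert k S, (fun z : ℕ → Z => z i) ⁻¹' s i).indicator
        (fun _ => (1 : ℝ)) = fun z => B.indicator (fun _ => 1) z * (s k).indicator 1 (z k) := by
      rw [Finset.set_biInter_insert, Set.inter_comm]
      exact Set.inter_indicator_one
    have indicator_le : ∀ x, ‖(s k).indicator (1 : Z → ℝ) x‖ ≤ 1 := fun x =>
      (norm_indicator_le_norm_self _ _).trans norm_one.le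
    have factor := hR.condExp_mul_eval
      (measurable_one.indicator (hs k (Finset.mem_insert_self k S))) indicator_le
      ((integrable_const (1 : ℝ)).indicator hBm) indicator_B_swap
    rw [indicator_insert, Finset.prod_insert hk]
    filter_upwards [factor, ih fun i hi => hs i (Finset.mem_insert_of_mem hi)] with z hz hih
    rw [hz, Pi.mul_apply, Pi.mul_apply, hih, mul_comm]
    rfl

end ConditionalIndependence

section DeFinetti

variable {Z : Type*} [MeasurableSpace Z] [StandardBorelSpace Z] {R : ProbabilityMeasure (ℕ → Z)}

theorem ae_condExpKernel_preimage_eval (hR : IsExchangeable R) (i : ℕ) {s : Set Z}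
    (hs : MeasurableSet s) :
    ∀ᵐ z ∂(R : Measure (ℕ → Z)),
      condExpKernel (R : Measure (ℕ → Z)) (exchangeableSigmaAlgebra Z) z ((fun z => z i) ⁻¹' s) =
        directingKernel R z s := by
  have hm := exchangeableSigmaAlgebra_le (Z := Z)
  have condExp_eq := hR.condExp_comp_swap (g := ((fun z => z 0) ⁻¹' s).indicator fun _ => (1 : ℝ))
    ((integrable_const _).indicator (measurable_pi_apply 0 hs)) 0 i
  have indicator_swap : (fun z : ℕ → Z => ((fun z => z 0) ⁻¹' s).indicator (fun _ => (1 : ℝ))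
      (z ∘ Equiv.swap 0 i)) = ((fun z => z i) ⁻¹' s).indicator fun _ => 1 := by
    funext z
    exact Set.indicator_const_eq_indicator_const (by simp)
  rw [indicator_swap] at condExp_eq
  filter_upwards [condExpKernel_ae_eq_condExp (μ := (R : Measure (ℕ → Z))) hm
      (measurable_pi_apply i hs),
    condExpKernel_ae_eq_condExp (μ := (R : Measure (ℕ → Z))) hm (measurable_pi_apply 0 hs),
    condExp_eq] with z hi h0 hz
  rw [directingKernel, Kernel.map_apply' _ (measurable_pi_apply 0) _ hs,
    ← measureReal_eq_measureReal_iff, hi, h0, hz]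

theorem measure_pi_eq_lintegral_prod (hR : IsExchangeable R) (I : Finset ℕ) {t : ℕ → Set Z}
    (ht : ∀ i, MeasurableSet (t i)) :
    (R : Measure (ℕ → Z)) ((I : Set ℕ).pi t) =
      ∫⁻ z, ∏ i ∈ I, directingKernel R z (t i) ∂(R : Measure (ℕ → Z)) := by
  have hm := exchangeableSigmaAlgebra_le (Z := Z)
  have hbox : MeasurableSet ((I : Set ℕ).pi t) := .pi I.countable_toSet fun i _ => ht i
  have cond_indep := ae_of_ae_trim hm <|
    (Kernel.iIndepFun_iff_measure_inter_preimage_eq_mul _ _).1 hR.iCondIndepFun_eval I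
      (sets := t) fun i _ => ht i
  have ident_distrib := ae_all_iff.2 fun i => hR.ae_condExpKernel_preimage_eval i (ht i)
  calc (R : Measure (ℕ → Z)) ((I : Set ℕ).pi t)
      = ∫⁻ z, condExpKernel (R : Measure (ℕ → Z)) (exchangeableSigmaAlgebra Z) z
          ((I : Set ℕ).pi t) ∂(R : Measure (ℕ → Z)) := by
        rw [← lintegral_trim hm (measurable_condExpKernel hbox),
          ← Measure.bind_apply hbox (Kernel.aemeasurable _), condExpKernel_comp_trim]
    _ = ∫⁻ z, ∏ i ∈ I, directingKernel R z (t i) ∂(R : Measure (ℕ → Z)) := by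
        refine lintegral_congr_ae ?_
        filter_upwards [cond_indep, ident_distrib] with z hind hid
        rw [Set.pi_def]
        exact hind.trans (Finset.prod_congr rfl fun i _ => hid i)

theorem eq_bind_infinitePi_directingKernel (hR : IsExchangeable R) :
    (R : Measure (ℕ → Z)) =
      (R : Measure (ℕ → Z)).bind fun z => Measure.infinitePi fun _ => directingKernel R z := by
  refine measure_ext_of_finite_pi fun I t ht => ?_
  rw [Measure.bind_apply (.pi I.countable_toSet fun i _ => ht i)
    (measurable_infinitePi_directingKernel R).aemeasurable, hR.measure_pi_eq_lintegral_prod I ht]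
  exact lintegral_congr fun z => (Measure.infinitePi_pi _ fun i _ => ht i).symm

end DeFinetti

end IsExchangeable

section UpperFunctionals

variable {Z : Type*} [MeasurableSpace Z]

instance (Q : ProbabilityMeasure Z) : IsProbabilityMeasure (iidMeasure Q) := by
  unfold iidMeasure
  infer_instance

theorem isExchangeable_iidMeasure (Q : ProbabilityMeasure Z) :
    IsExchangeable ⟨iidMeasure Q, inferInstance⟩ := fun i j =>
  Measure.map_infinitePi_infinitePi_of_inj (Equiv.swap i j).injective

theorem UXE_eq_URE [StandardBorelSpace Z] {F : (ℕ → Z) → ℝ≥0∞} (hF : Measurable F) :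
    UXE F = URE F := by
  refine le_antisymm (iSup₂_le fun R hR => ?_) (iSup_le fun Q =>
    le_iSup₂_of_le (⟨iidMeasure Q, inferInstance⟩ : ProbabilityMeasure (ℕ → Z))
      (isExchangeable_iidMeasure Q) le_rfl)
  calc ∫⁻ z, F z ∂(R : Measure (ℕ → Z))
      = ∫⁻ z, ∫⁻ w, F w ∂(Measure.infinitePi fun _ => directingKernel R z)
          ∂(R : Measure (ℕ → Z)) := by
        conv_lhs => rw [hR.eq_bind_infinitePi_directingKernel]
        exact Measure.lintegral_bind (measurable_infinitePi_directingKernel R).aemeasurable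
          hF.aemeasurable
    _ ≤ ∫⁻ _, URE F ∂(R : Measure (ℕ → Z)) := lintegral_mono fun z =>
        le_iSup (fun Q : ProbabilityMeasure Z => ∫⁻ w, F w ∂(iidMeasure Q))
          ⟨directingKernel R z, inferInstance⟩
    _ = URE F := by rw [lintegral_const, measure_univ, mul_one]

theorem UXP_eq_URP [StandardBorelSpace Z] {A : Set (ℕ → Z)} (hA : MeasurableSet A) :
    UXP A = URP A := by
  simpa only [UXE, URE, lintegral_indicator_one hA] using!
    UXE_eq_URE (F := A.indicator 1) (measurable_one.indicator hA)

end UpperFunctionals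

theorem mainTheorem3 {Z : Type*} [MeasurableSpace Z] [StandardBorelSpace Z] :
    (∀ A : Set (ℕ → Z), MeasurableSet A → UXP A = URP A) ∧
    (∀ F : (ℕ → Z) → ℝ≥0∞, Measurable F → UXE F = URE F) ∧
    (∀ ε ∈ Set.Ioo (0 : ℝ) 1, ∀ A : Set (ℕ → Z),
      IsExchangeabilityCriticalRegion ε A ↔ IsRandomnessCriticalRegion ε A) ∧
    (∀ P : (ℕ → Z) → unitInterval,
      IsExchangeabilityPVariable P ↔ IsRandomnessPVariable P) ∧
    (∀ F : (ℕ → Z) → ℝ≥0∞,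
      IsExchangeabilityEVariable F ↔ IsRandomnessEVariable F) := by
  refine ⟨fun A hA => UXP_eq_URP hA, fun F hF => UXE_eq_URE hF, fun ε _ A => ?_, fun P => ?_,
    fun F => ?_⟩
  · exact and_congr_right fun hA => by rw [UXP_eq_URP hA]
  · refine and_congr_right fun hP => forall₂_congr fun ε _ => ?_
    have hA : MeasurableSet {z | (P z : ℝ) ≤ ε} :=
      measurableSet_le (measurable_subtype_coe.comp hP) measurable_const
    rw [UXP_eq_URP hA]
  · exact and_congr_right fun hF => by rw [UXE_eq_URE hF]
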